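/- Let $G$ be a finite weighted tree with at least two nodes: a finite connected acyclic graph on a node set $\mathcal N$ with symmetric link weights $c_{ij}>0$ on the links (and $c_{ij}=0$ if $i,j$ are not linked). A distribution on $G$ is a function $p:\mathcal N\to\mathbb R$ with $p_i\ge 0$ and $\sum_i p_i=1$. For a function $d:\mathcal N\times\mathcal N\to\mathbb R$, the variance of $p$ with respect to $d$ is $\operatorname{var}_d(p)=\frac12\sum_{i,j}p_ip_j\,d(i,j)^2$, and a maximum variance distribution with respect to $d$ is a distribution that maximizes $\operatorname{var}_d$ over all distributions. The support of $p$ is $\{i:p_i>0\}$, and a leaf is a node with exactly one incident link. Let $Q$ be the Laplacian matrix ($Q_{ii}=\sum_k c_{ik}$, $Q_{ij}=-c_{ij}$ for $i\ne j$), $Q^\dagger$ its Moore–Penrose pseudoinverse, and $\omega_{ij}=(e_i-e_j)^TQ^\dagger(e_i-e_j)$ the effective resistance. (a) The support $\mathcal V^\star$ of the maximum variance distribution with respect to the square root effective resistance $\sqrt{\omega}$, i.e. of every distribution $p$ that maximizes $\operatorname{var}_{\sqrt\omega}(p)=\frac12\sum_{i,j}p_ip_j\omega_{ij}$, consists only of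 leaves. (b) More generally, let $d:\mathcal N\times\mathcal N\to\mathbb R$ be any distance function ($d(i,i)=0$, $d(i,j)=d(j,i)$, and $d(i,j)>0$ for $i\neq j$) that is additive across cut vertices: $d(i,j)=d(i,x)+d(x,j)$ whenever removing the node $x$ from $G$ disconnects $i$ and $j$. Then the support of every maximum variance distribution with respect to $\sqrt d$ (that is, with $d$ in the role of $\omega$), and likewise of every maximum variance distribution with respect to $d$ itself, consists only of leaves. -/

import Mathlib

namespace GraphVariance

/-- A weighted graph without loops on the node set `V`. The pair `i, j` is a link iff
`weight i j > 0`; `weight i j = 0` means that there is no link. -/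
structure WeightedGraph (V : Type*) where
  weight : V → V → ℝ
  weight_nonneg : ∀ i j, 0 ≤ weight i j
  weight_symm : ∀ i j, weight i j = weight j i
  weight_self : ∀ i, weight i i = 0

/-- `X` is the Moore-Penrose inverse of the real matrix `A` (the four Penrose equations). -/
structure IsMoorePenroseInverse {V : Type*} [Fintype V] (A X : Matrix V V ℝ) : Prop where
  mul_mul_left : A * X * A = A
  mul_mul_right : X * A * X = X
  symm_left : (A * X).transpose = A * X
  symm_right : (X * A).transpose = X * A

theorem IsMoorePenroseInverse.unique {V : Type*} [Fintype V] {A X Y : Matrix V V ℝ}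
    (hX : IsMoorePenroseInverse A X) (hY : IsMoorePenroseInverse A Y) : X = Y := by
  have h1 : A * X = A * Y := by
    calc A * X = (A * X).transpose := hX.symm_left.symm
      _ = (A * Y * (A * X)).transpose := by
          rw [← Matrix.mul_assoc, hY.mul_mul_left]
      _ = A * X * (A * Y) := by rw [Matrix.transpose_mul, hX.symm_left, hY.symm_left]
      _ = A * Y := by rw [← Matrix.mul_assoc, hX.mul_mul_left]
  have h2 : X * A = Y * A := by
    calc X * A = (X * A).transpose := hX.symm_right.symm
      _ = (X * A * (Y * A)).transpose := by
          rw [Matrix.mul_assoc, ← Matrix.mul_assoc A, hY.mul_mul_left]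
      _ = Y * A * (X * A) := by rw [Matrix.transpose_mul, hX.symm_right, hY.symm_right]
      _ = Y * A := by rw [Matrix.mul_assoc, ← Matrix.mul_assoc A, hX.mul_mul_left]
  calc X = X * A * X := hX.mul_mul_right.symm
    _ = Y * A * Y := by rw [h2, Matrix.mul_assoc, h1, ← Matrix.mul_assoc]
    _ = Y := hY.mul_mul_right

theorem exists_isMoorePenroseInverse {V : Type*} [Fintype V] [DecidableEq V]
    {A : Matrix V V ℝ} (hA : A.transpose = A) : ∃ X, IsMoorePenroseInverse A X := by
  have hH : A.IsHermitian := by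
    rw [Matrix.IsHermitian, Matrix.conjTranspose_eq_transpose_of_trivial, hA]
  obtain ⟨U, D, hU, hAU⟩ : ∃ (U : Matrix V V ℝ) (D : V → ℝ), U.transpose * U = 1 ∧
      A = U * Matrix.diagonal D * U.transpose := by
    refine ⟨(hH.eigenvectorUnitary : Matrix V V ℝ), hH.eigenvalues, ?_, ?_⟩
    · have := Unitary.coe_star_mul_self hH.eigenvectorUnitary
      rwa [Matrix.star_eq_conjTranspose, Matrix.conjTranspose_eq_transpose_of_trivial] at this
    · have := hH.spectral_theorem
      rw [Unitary.conjStarAlgAut_apply, Matrix.star_eq_conjTranspose,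
        Matrix.conjTranspose_eq_transpose_of_trivial] at this
      exact this
  have key : ∀ a b : V → ℝ, U * Matrix.diagonal a * U.transpose *
      (U * Matrix.diagonal b * U.transpose) =
      U * Matrix.diagonal (fun i => a i * b i) * U.transpose := by
    intro a b
    calc _ = U * Matrix.diagonal a * (U.transpose * U) * Matrix.diagonal b * U.transpose := by
            simp only [Matrix.mul_assoc]
      _ = _ := by
            rw [hU, Matrix.mul_one, Matrix.mul_assoc U, Matrix.diagonal_mul_diagonal]
  have tr : ∀ a : V → ℝ, (U * Matrix.diagonal a * U.transpose).transpose =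
      U * Matrix.diagonal a * U.transpose := by
    intro a
    simp [Matrix.transpose_mul, Matrix.mul_assoc]
  have inv_cancel : ∀ a : ℝ, a⁻¹ * a * a⁻¹ = a⁻¹ := fun a => by
    simpa using mul_inv_mul_cancel a⁻¹
  refine ⟨U * Matrix.diagonal (fun i => (D i)⁻¹) * U.transpose, ?_, ?_, ?_, ?_⟩ <;>
    simp only [hAU, key, tr, mul_inv_mul_cancel, inv_cancel]

open Classical in
/-- The Moore-Penrose inverse of a real square matrix. -/
noncomputable def pinv {V : Type*} [Fintype V] (A : Matrix V V ℝ) : Matrix V V ℝ :=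
  if h : ∃ X, IsMoorePenroseInverse A X then h.choose else 0

theorem pinv_spec {V : Type*} [Fintype V] [DecidableEq V]
    {A : Matrix V V ℝ} (hA : A.transpose = A) : IsMoorePenroseInverse A (pinv A) := by
  have h := exists_isMoorePenroseInverse hA
  rw [pinv, dif_pos h]
  exact h.choose_spec

namespace WeightedGraph

/-- The underlying simple graph, whose edges are the links. -/
def graph {V : Type*} (G : WeightedGraph V) : SimpleGraph V where
  Adj i j := 0 < G.weight i j
  symm := ⟨fun i j h => by rw [G.weight_symm j i]; exact h⟩
  loopless := ⟨fun i h => by rw [G.weight_self i] at h; exact lt_irrefl 0 h⟩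

/-- The Laplacian matrix: weighted degrees on the diagonal, minus the link weights off it. -/
def laplacian {V : Type*} [Fintype V] [DecidableEq V] (G : WeightedGraph V) : Matrix V V ℝ :=
  Matrix.of fun i j => if i = j then ∑ k, G.weight i k else -G.weight i j

/-- The effective resistance `ω i j = (e_i - e_j)ᵀ Q† (e_i - e_j)`. -/
noncomputable def effectiveResistance {V : Type*} [Fintype V] [DecidableEq V]
    (G : WeightedGraph V) (i j : V) : ℝ :=
  let e : V → ℝ := Pi.single i 1 - Pi.single j 1
  e ⬝ᵥ Matrix.mulVec (pinv G.laplacian) e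

end WeightedGraph

/-- The variance of `p` with respect to a distance `d` between the nodes. -/
noncomputable def variance {V : Type*} [Fintype V] (d : V → V → ℝ) (p : V → ℝ) : ℝ :=
  (1 / 2) * ∑ i, ∑ j, p i * p j * d i j ^ 2

/-- `p` is a maximum variance distribution with respect to the distance `d`. -/
def IsMaxVarianceDistribution {V : Type*} [Fintype V] (d : V → V → ℝ) (p : V → ℝ) : Prop :=
  p ∈ stdSimplex ℝ V ∧ IsMaxOn (variance d) (stdSimplex ℝ V) p

/-- A node with exactly one incident link. -/
def IsLeaf {V : Type*} (G : SimpleGraph V) (i : V) : Prop :=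
  ∃! j, G.Adj i j

/-- Removing the node `x` from the graph disconnects the nodes `i` and `j`. -/
def RemovalDisconnects {V : Type*} (G : SimpleGraph V) (x i j : V) : Prop :=
  ∃ (hi : i ∈ ({x}ᶜ : Set V)) (hj : j ∈ ({x}ᶜ : Set V)),
    ¬ (G.induce ({x}ᶜ : Set V)).Reachable ⟨i, hi⟩ ⟨j, hj⟩

/-- A distance function on the nodes; the triangle inequality is not required. -/
structure IsDistance {V : Type*} (d : V → V → ℝ) : Prop where
  self : ∀ i, d i i = 0
  pos : ∀ i j, i ≠ j → 0 < d i j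
  symm : ∀ i j, d i j = d j i

/-- `d` is additive across cut vertices of `G`. -/
def AdditiveAcrossCuts {V : Type*} (G : SimpleGraph V) (d : V → V → ℝ) : Prop :=
  ∀ x i j, RemovalDisconnects G x i j → d i j = d i x + d x j

end GraphVariance

namespace GraphVariance

open Matrix

/-! ### Trees: how distances change along a link -/

section Tree

variable {V : Type*} {G : SimpleGraph V}

/-! At a maximizer `p`, the first-order condition says that `F y = ∑ j, p j * d y j` (with `d ^ 2`
when the variance is taken for `d` itself) is maximal over all nodes at each node `x` of the
support. If `x` is not a leaf, take two neighbours `a`, `b`. They lie in different components of the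
tree without `x`, so stepping to `a` or to `b` shortens the distance to `j` in at most one of the
two cases and lengthens it in the other. Weighting the step to `a` by `d b x` and the step to `b` by
`d a x` makes these changes cancel at worst, while `j = x` gives a strict gain. Hence `F a` or `F b`
exceeds `F x`, a contradiction.

Effective resistance is a special case: the potential of a current from `i` to a cut vertex `x` is
constant beyond `x`, which gives additivity. -/

theorem exists_isPath_of_reachable_induce_compl {x i j : V} {hi : i ∈ ({x}ᶜ : Set V)}
    {hj : j ∈ ({x}ᶜ : Set V)}
    (h : (G.induce ({x}ᶜ : Set V)).Reachable ⟨i, hi⟩ ⟨j, hj⟩) :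
    ∃ w : G.Walk i j, w.IsPath ∧ x ∉ w.support := by
  obtain ⟨w, hw⟩ := h.exists_isPath
  let f : G.induce ({x}ᶜ : Set V) →g G := (SimpleGraph.Embedding.induce _).toHom
  refine ⟨w.map f, hw.map Subtype.val_injective, fun hx => ?_⟩
  obtain ⟨y, -, hy⟩ := List.mem_map.1 ((w.support_map f).subst (motive := (x ∈ ·)) hx)
  exact y.2 hy

/-- The unique path from `a` to `b` is `a, x, b`, so none avoids `x`. -/
theorem removalDisconnects_neighbors (hG : G.IsTree) {x a b : V} (ha : G.Adj x a)
    (hb : G.Adj x b) (hab : a ≠ b) : RemovalDisconnects G x a b := by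
  refine ⟨ha.ne', hb.ne', fun h => ?_⟩
  obtain ⟨w, hw, hx⟩ := exists_isPath_of_reachable_induce_compl h
  let u : G.Walk a b := .cons ha.symm (.cons hb .nil)
  have hu : u.IsPath := by
    simp [u, SimpleGraph.Walk.isPath_def, ha.ne', hb.ne, hab]
  have huw : u = w :=
    congrArg Subtype.val ((hG.isAcyclic.subsingleton_path _ _).elim ⟨u, hu⟩ ⟨w, hw⟩)
  rw [← huw] at hx
  simp [u] at hx

/-- Prefixing `x` to a path from `a` to `j` off `x` gives the only path from `x` to `j`, and it
meets `a`. -/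
theorem removalDisconnects_of_reachable (hG : G.IsTree) {x a j : V} (ha : G.Adj x a)
    (hja : j ≠ a) {hi : a ∈ ({x}ᶜ : Set V)} {hj : j ∈ ({x}ᶜ : Set V)}
    (h : (G.induce ({x}ᶜ : Set V)).Reachable ⟨a, hi⟩ ⟨j, hj⟩) :
    RemovalDisconnects G a x j := by
  refine ⟨ha.ne, hja, fun h' => ?_⟩
  obtain ⟨w, hw, hx⟩ := exists_isPath_of_reachable_induce_compl h
  obtain ⟨w', hw', ha'⟩ := exists_isPath_of_reachable_induce_compl h'
  have hu : (SimpleGraph.Walk.cons ha w).IsPath := (SimpleGraph.Walk.cons_isPath_iff _ _).2 ⟨hw, hx⟩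
  have huw : SimpleGraph.Walk.cons ha w = w' :=
    congrArg Subtype.val ((hG.isAcyclic.subsingleton_path _ _).elim ⟨_, hu⟩ ⟨w', hw'⟩)
  rw [← huw] at ha'
  simp at ha'

/-- Moving from `x` to a neighbour `a` changes the distance to `j` by the length of the link, with
a negative sign exactly on the side of `a`. -/
theorem AdditiveAcrossCuts.dist_neighbor (hG : G.IsTree) {d : V → V → ℝ} (hd : IsDistance d)
    (hadd : AdditiveAcrossCuts G d) {x a j : V} (ha : G.Adj x a) :
    d a j = d x j + d a x ∨ (d a j = d x j - d a x ∧ j ≠ x ∧ ¬ RemovalDisconnects G x a j) := by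
  by_cases hjx : j = x
  · left; rw [hjx, hd.self]; ring
  by_cases hr : RemovalDisconnects G x a j
  · left; rw [hadd x a j hr]; ring
  right
  refine ⟨?_, hjx, hr⟩
  by_cases hja : j = a
  · rw [hja, hd.self, hd.symm x a]; ring
  have hreach : (G.induce ({x}ᶜ : Set V)).Reachable ⟨a, ha.ne'⟩ ⟨j, hjx⟩ := by
    by_contra hn
    exact hr ⟨_, _, hn⟩
  rw [hadd a x j (removalDisconnects_of_reachable hG ha hja hreach), hd.symm x a]; ring

/-- Two minus signs cannot occur together: `j` would then join `a` to `b` off `x`. -/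
theorem AdditiveAcrossCuts.dist_two_neighbors (hG : G.IsTree) {d : V → V → ℝ}
    (hd : IsDistance d) (hadd : AdditiveAcrossCuts G d) {x a b : V} (ha : G.Adj x a)
    (hb : G.Adj x b) (hab : a ≠ b) (j : V) :
    (d a j = d x j + d a x ∧ d b j = d x j + d b x) ∨
    (d a j = d x j + d a x ∧ d b j = d x j - d b x) ∨
    (d a j = d x j - d a x ∧ d b j = d x j + d b x) := by
  rcases hadd.dist_neighbor hG hd ha (j := j) with h₁ | ⟨h₁, hj, hr₁⟩ <;>
    rcases hadd.dist_neighbor hG hd hb (j := j) with h₂ | ⟨h₂, -, hr₂⟩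
  · exact .inl ⟨h₁, h₂⟩
  · exact .inr (.inl ⟨h₁, h₂⟩)
  · exact .inr (.inr ⟨h₁, h₂⟩)
  · exfalso
    obtain ⟨h1, h2, h3⟩ := removalDisconnects_neighbors hG ha hb hab
    have r₁ : (G.induce ({x}ᶜ : Set V)).Reachable ⟨a, h1⟩ ⟨j, hj⟩ := by
      by_contra hn
      exact hr₁ ⟨_, _, hn⟩
    have r₂ : (G.induce ({x}ᶜ : Set V)).Reachable ⟨b, h2⟩ ⟨j, hj⟩ := by
      by_contra hn
      exact hr₂ ⟨_, _, hn⟩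
    exact h3 (r₁.trans r₂.symm)

theorem exists_two_neighbors_of_not_isLeaf [Nontrivial V] (hG : G.Connected) {x : V}
    (hx : ¬ IsLeaf G x) : ∃ a b, G.Adj x a ∧ G.Adj x b ∧ a ≠ b := by
  obtain ⟨a, ha⟩ := hG.preconnected.exists_adj_of_nontrivial x
  by_contra! h
  exact hx ⟨a, ha, fun b hb => h b a hb ha⟩

end Tree

/-! ### First-order optimality and the exclusion of non-leaves -/

section Optimality

variable {V : Type*} [Fintype V]

theorem variance_eq_dotProduct (d : V → V → ℝ) (p : V → ℝ) :
    variance d p = 1 / 2 * (p ⬝ᵥ (Matrix.of fun i j => d i j ^ 2) *ᵥ p) := by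
  simp only [variance, dotProduct, mulVec, Matrix.of_apply, Finset.mul_sum]
  refine Finset.sum_congr rfl fun i _ => Finset.sum_congr rfl fun j _ => ?_
  ring

/-- First-order optimality: moving mass away from a node of the support does not increase the
variance. -/
theorem IsMaxVarianceDistribution.sum_le_sum {d : V → V → ℝ} {p : V → ℝ}
    (hp : IsMaxVarianceDistribution d p) (hsymm : ∀ i j, d i j = d j i) (hself : ∀ i, d i i = 0)
    {x : V} (hx : 0 < p x) (a : V) :
    ∑ j, p j * d a j ^ 2 ≤ ∑ j, p j * d x j ^ 2 := by
  classical
  rcases eq_or_ne a x with rfl | hax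
  · rfl
  obtain ⟨⟨hnn, hsum⟩, hmax⟩ := hp
  set D : Matrix V V ℝ := Matrix.of fun i j => d i j ^ 2 with hD
  have hDt : Dᵀ = D := by
    ext i j
    simp [hD, hsymm i j]
  set e : V → ℝ := Pi.single a 1 - Pi.single x 1 with he
  have hrow : ∀ i, (D *ᵥ p) i = ∑ j, p j * d i j ^ 2 := fun i => by
    simp [hD, mulVec, dotProduct, mul_comm]
  -- Moving mass `t` from `x` to `a` changes the variance by exactly the left side minus the right
  -- side.
  have hstep : ∀ t, 0 < t → t ≤ p x →
      t * ((D *ᵥ p) a - (D *ᵥ p) x) ≤ t ^ 2 * d a x ^ 2 := by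
    intro t ht htx
    have hq : p + t • e ∈ stdSimplex ℝ V := by
      refine ⟨fun i => ?_, ?_⟩
      · rcases eq_or_ne i x with rfl | hix
        · simp [he, hax.symm]; linarith
        · have := hnn i
          rcases eq_or_ne i a with rfl | hia
          · simp [he, hix]; linarith
          · simpa [he, hix, hia] using this
      · simp [he, Finset.sum_add_distrib, ← Finset.mul_sum, hsum]
    have h := hmax hq
    simp only [Set.mem_ofPred_eq, variance_eq_dotProduct, ← hD] at h
    have hep : e ⬝ᵥ D *ᵥ p = (D *ᵥ p) a - (D *ᵥ p) x := by
      simp [he, sub_dotProduct]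
    have hpe : p ⬝ᵥ D *ᵥ e = e ⬝ᵥ D *ᵥ p := by
      rw [dotProduct_mulVec, ← mulVec_transpose, hDt, dotProduct_comm]
    have hee : e ⬝ᵥ D *ᵥ e = -2 * d a x ^ 2 := by
      simp [he, sub_dotProduct, mulVec_sub, hD, hself, hsymm x a]
      ring
    simp only [mulVec_add, mulVec_smul, dotProduct_add, add_dotProduct, dotProduct_smul,
      smul_dotProduct, smul_eq_mul, hpe, hee, hep] at h
    nlinarith
  rw [← hrow, ← hrow]
  by_contra! hlt
  set δ := (D *ᵥ p) a - (D *ᵥ p) x with hδ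
  have hδ0 : 0 < δ := sub_pos.2 hlt
  have hden : 0 < d a x ^ 2 + 1 := by positivity
  -- The `+ 1` makes the linear gain beat the quadratic loss strictly, and avoids dividing by zero.
  set t := min (p x) (δ / (d a x ^ 2 + 1)) with ht
  have ht0 : 0 < t := lt_min hx (by positivity)
  have h := hstep t ht0 (min_le_left _ _)
  have h' : t * (d a x ^ 2 + 1) ≤ δ := (le_div_iff₀ hden).1 (min_le_right _ _)
  have h'' : δ ≤ t * d a x ^ 2 := by
    refine le_of_mul_le_mul_left ?_ ht0
    linarith [h, (by ring : t ^ 2 * d a x ^ 2 = t * (t * d a x ^ 2))]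
  linarith

theorem IsMaxVarianceDistribution.sum_mul_le_sum_mul_of_sqrt {d : V → V → ℝ} {p : V → ℝ}
    (hd : IsDistance d) (hp : IsMaxVarianceDistribution (fun i j => √(d i j)) p)
    {x : V} (hx : 0 < p x) (a : V) : ∑ j, p j * d a j ≤ ∑ j, p j * d x j := by
  have hnn : ∀ i j, 0 ≤ d i j := fun i j => by
    rcases eq_or_ne i j with rfl | h
    · exact (hd.self i).ge
    · exact (hd.pos i j h).le
  have h := hp.sum_le_sum (fun i j => by simp only [hd.symm i j]) (fun i => by simp [hd.self]) hx a
  simpa only [Real.sq_sqrt (hnn _ _)] using h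

variable {G : SimpleGraph V} [Nontrivial V]

theorem support_subset_leaves_of_sqrt (hG : G.IsTree) {d : V → V → ℝ} (hd : IsDistance d)
    (hadd : AdditiveAcrossCuts G d) {p : V → ℝ}
    (hp : IsMaxVarianceDistribution (fun i j => √(d i j)) p) :
    {i | 0 < p i} ⊆ {i | IsLeaf G i} := by
  intro x hx
  by_contra hleaf
  obtain ⟨a, b, ha, hb, hab⟩ := exists_two_neighbors_of_not_isLeaf hG.connected hleaf
  have hA : 0 < d a x := hd.pos _ _ ha.ne'
  have hB : 0 < d b x := hd.pos _ _ hb.ne'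
  have h₁ := hp.sum_mul_le_sum_mul_of_sqrt hd hx a
  have h₂ := hp.sum_mul_le_sum_mul_of_sqrt hd hx b
  -- Each bracket is `2 * d a x * d b x` or `0`; it is the former at `j = x`.
  have hpos : 0 < ∑ j, p j * (d b x * (d a j - d x j) + d a x * (d b j - d x j)) := by
    refine Finset.sum_pos' (fun j _ => mul_nonneg (hp.1.1 j) ?_)
      ⟨x, Finset.mem_univ x, mul_pos hx ?_⟩
    · rcases hadd.dist_two_neighbors hG hd ha hb hab j with ⟨h, h'⟩ | ⟨h, h'⟩ | ⟨h, h'⟩ <;>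
        rw [h, h'] <;> nlinarith [mul_pos hA hB]
    · rw [hd.self]; nlinarith [mul_pos hA hB]
  have heq : ∑ j, p j * (d b x * (d a j - d x j) + d a x * (d b j - d x j)) =
      d b x * (∑ j, p j * d a j - ∑ j, p j * d x j) +
        d a x * (∑ j, p j * d b j - ∑ j, p j * d x j) := by
    simp only [← Finset.sum_sub_distrib, Finset.mul_sum, ← Finset.sum_add_distrib]
    exact Finset.sum_congr rfl fun j _ => by ring
  nlinarith

theorem support_subset_leaves (hG : G.IsTree) {d : V → V → ℝ} (hd : IsDistance d)
    (hadd : AdditiveAcrossCuts G d) {p : V → ℝ} (hp : IsMaxVarianceDistribution d p) :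
    {i | 0 < p i} ⊆ {i | IsLeaf G i} := by
  intro x hx
  by_contra hleaf
  obtain ⟨a, b, ha, hb, hab⟩ := exists_two_neighbors_of_not_isLeaf hG.connected hleaf
  have hA : 0 < d a x := hd.pos _ _ ha.ne'
  have hB : 0 < d b x := hd.pos _ _ hb.ne'
  have h₁ := hp.sum_le_sum hd.symm hd.self hx a
  have h₂ := hp.sum_le_sum hd.symm hd.self hx b
  -- The squares of the link lengths always contribute `d a x * d b x * (d a x + d b x)`; the cross
  -- terms add `4 * d a x * d b x * d x j` or cancel.
  have key : ∀ j, 0 < d b x * (d a j ^ 2 - d x j ^ 2) + d a x * (d b j ^ 2 - d x j ^ 2) := by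
    intro j
    have hxj : 0 ≤ d x j := by
      rcases eq_or_ne x j with rfl | h
      · exact (hd.self x).ge
      · exact (hd.pos x j h).le
    have hl : 0 < d a x * d b x * (d a x + d b x) := by positivity
    have hl' : 0 ≤ d a x * d b x * d x j := by positivity
    rcases hadd.dist_two_neighbors hG hd ha hb hab j with ⟨h, h'⟩ | ⟨h, h'⟩ | ⟨h, h'⟩ <;>
      rw [h, h'] <;> linarith
  have hpos : 0 < ∑ j, p j *
      (d b x * (d a j ^ 2 - d x j ^ 2) + d a x * (d b j ^ 2 - d x j ^ 2)) :=
    Finset.sum_pos' (fun j _ => mul_nonneg (hp.1.1 j) (key j).le)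
      ⟨x, Finset.mem_univ x, mul_pos hx (key x)⟩
  have heq : ∑ j, p j * (d b x * (d a j ^ 2 - d x j ^ 2) + d a x * (d b j ^ 2 - d x j ^ 2)) =
      d b x * (∑ j, p j * d a j ^ 2 - ∑ j, p j * d x j ^ 2) +
        d a x * (∑ j, p j * d b j ^ 2 - ∑ j, p j * d x j ^ 2) := by
    simp only [← Finset.sum_sub_distrib, Finset.mul_sum, ← Finset.sum_add_distrib]
    exact Finset.sum_congr rfl fun j _ => by ring
  nlinarith

end Optimality

/-! ### Effective resistance: positivity and additivity across cuts -/

namespace WeightedGraph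

variable {V : Type*} [Fintype V] [DecidableEq V] (G : WeightedGraph V)

theorem laplacian_mulVec_apply (v : V → ℝ) (i : V) :
    (G.laplacian *ᵥ v) i = ∑ k, G.weight i k * (v i - v k) := by
  have h : ∀ k, G.laplacian i k * v k =
      (if i = k then (∑ l, G.weight i l) * v i else 0) - G.weight i k * v k := by
    intro k
    rcases eq_or_ne i k with rfl | hik
    · simp [laplacian, G.weight_self]
    · simp [laplacian, hik]
  simp only [mulVec, dotProduct, h, Finset.sum_sub_distrib, Finset.sum_ite_eq, Finset.mem_univ,
    if_true, mul_sub, Finset.sum_mul]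

theorem laplacian_transpose : G.laplacianᵀ = G.laplacian := by
  ext i j
  rcases eq_or_ne i j with rfl | hij
  · rfl
  · simp [laplacian, hij, hij.symm, G.weight_symm i j]

theorem dotProduct_laplacian_mulVec (v : V → ℝ) :
    v ⬝ᵥ G.laplacian *ᵥ v = 1 / 2 * ∑ i, ∑ j, G.weight i j * (v i - v j) ^ 2 := by
  have h₁ : v ⬝ᵥ G.laplacian *ᵥ v = ∑ i, ∑ j, v i * (G.weight i j * (v i - v j)) := by
    simp only [dotProduct, laplacian_mulVec_apply, Finset.mul_sum]
  have h₂ : v ⬝ᵥ G.laplacian *ᵥ v = ∑ i, ∑ j, v j * (G.weight i j * (v j - v i)) := by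
    rw [h₁, Finset.sum_comm]
    refine Finset.sum_congr rfl fun i _ => Finset.sum_congr rfl fun j _ => ?_
    rw [G.weight_symm]
  have h₃ : ∑ i, ∑ j, G.weight i j * (v i - v j) ^ 2 =
      v ⬝ᵥ G.laplacian *ᵥ v + v ⬝ᵥ G.laplacian *ᵥ v := by
    nth_rewrite 1 [h₁]
    rw [h₂]
    simp only [← Finset.sum_add_distrib]
    refine Finset.sum_congr rfl fun i _ => Finset.sum_congr rfl fun j _ => ?_
    ring
  rw [h₃]; ring

theorem dotProduct_laplacian_mulVec_nonneg (v : V → ℝ) : 0 ≤ v ⬝ᵥ G.laplacian *ᵥ v := by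
  rw [dotProduct_laplacian_mulVec]
  have := Finset.sum_nonneg fun i (_ : i ∈ Finset.univ) =>
    Finset.sum_nonneg fun j (_ : j ∈ Finset.univ) =>
      mul_nonneg (G.weight_nonneg i j) (sq_nonneg (v i - v j))
  positivity

variable {G}

theorem eq_of_dotProduct_laplacian_mulVec_eq_zero (hG : G.graph.Connected) {v : V → ℝ}
    (hv : v ⬝ᵥ G.laplacian *ᵥ v = 0) (i j : V) : v i = v j := by
  have hnn : ∀ i j, 0 ≤ G.weight i j * (v i - v j) ^ 2 := fun i j =>
    mul_nonneg (G.weight_nonneg i j) (sq_nonneg _)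
  have hsum : ∑ i, ∑ j, G.weight i j * (v i - v j) ^ 2 = 0 := by
    rw [dotProduct_laplacian_mulVec] at hv
    linarith
  have hadj : ∀ i j, G.graph.Adj i j → v i = v j := by
    intro i j (hij : 0 < G.weight i j)
    rw [Finset.sum_eq_zero_iff_of_nonneg fun i _ => Finset.sum_nonneg fun j _ => hnn i j] at hsum
    have h := hsum i (Finset.mem_univ i)
    rw [Finset.sum_eq_zero_iff_of_nonneg fun j _ => hnn i j] at h
    have h' := h j (Finset.mem_univ j)
    have := (mul_eq_zero.1 h').resolve_left hij.ne'
    exact sub_eq_zero.1 (pow_eq_zero_iff two_ne_zero |>.1 this)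
  obtain ⟨w⟩ := hG.preconnected i j
  induction w with
  | nil => rfl
  | cons h _ ih => exact (hadj _ _ h).trans ih

theorem pinv_laplacian_transpose : (pinv G.laplacian)ᵀ = pinv G.laplacian := by
  have h := pinv_spec G.laplacian_transpose
  have hQ := G.laplacian_transpose
  refine IsMoorePenroseInverse.unique (A := G.laplacian) ⟨?_, ?_, ?_, ?_⟩ h
  · have := congrArg transpose h.mul_mul_left
    simpa [transpose_mul, hQ, Matrix.mul_assoc] using this
  · have := congrArg transpose h.mul_mul_right
    simpa [transpose_mul, hQ, Matrix.mul_assoc] using this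
  · have := h.symm_right
    rw [transpose_mul, hQ] at this
    rw [this, ← this, transpose_mul, hQ, transpose_transpose]
    exact this.symm
  · have := h.symm_left
    rw [transpose_mul, hQ] at this
    rw [this, ← this, transpose_mul, hQ, transpose_transpose]
    exact this.symm

theorem laplacian_mul_pinv_comm :
    G.laplacian * pinv G.laplacian = pinv G.laplacian * G.laplacian := by
  have h := (pinv_spec G.laplacian_transpose).symm_left
  rw [transpose_mul, G.laplacian_transpose, pinv_laplacian_transpose] at h
  exact h.symm

theorem sum_laplacian_mulVec (v : V → ℝ) : ∑ i, (G.laplacian *ᵥ v) i = 0 := by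
  have h : (fun _ => (1 : ℝ)) ⬝ᵥ G.laplacian *ᵥ v = 0 := by
    rw [dotProduct_mulVec, ← mulVec_transpose, G.laplacian_transpose]
    have : G.laplacian *ᵥ (fun _ => (1 : ℝ)) = 0 := by
      ext i
      simp [laplacian_mulVec_apply]
    rw [this, zero_dotProduct]
  simpa [dotProduct] using h

/-- The residual lies in the kernel of the Laplacian, so it is constant; its entries sum to zero, so
it vanishes. -/
theorem laplacian_mulVec_pinv_mulVec (hG : G.graph.Connected) {e : V → ℝ} (he : ∑ i, e i = 0) :
    G.laplacian *ᵥ (pinv G.laplacian *ᵥ e) = e := by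
  set r := e - G.laplacian *ᵥ (pinv G.laplacian *ᵥ e) with hr
  have hQr : G.laplacian *ᵥ r = 0 := by
    rw [hr, mulVec_sub, mulVec_mulVec, mulVec_mulVec, Matrix.mul_assoc, laplacian_mul_pinv_comm,
      ← Matrix.mul_assoc, (pinv_spec G.laplacian_transpose).mul_mul_left, sub_self]
  have hconst := eq_of_dotProduct_laplacian_mulVec_eq_zero hG (v := r) (by rw [hQr, dotProduct_zero])
  have hsum : ∑ i, r i = 0 := by
    simp only [hr, Pi.sub_apply, Finset.sum_sub_distrib, he, sum_laplacian_mulVec, sub_self]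
  have hr0 : r = 0 := by
    ext i
    have h : ∑ j, r j = ∑ _j : V, r i := Finset.sum_congr rfl fun j _ => hconst j i
    rw [hsum, Finset.sum_const, nsmul_eq_mul] at h
    have : ((Finset.univ : Finset V).card : ℝ) ≠ 0 := by
      exact_mod_cast (Finset.card_pos.2 ⟨i, Finset.mem_univ i⟩).ne'
    exact (mul_eq_zero.1 h.symm).resolve_left this
  exact (sub_eq_zero.1 (hr ▸ hr0)).symm

theorem sum_single_sub_single (i j : V) :
    ∑ k, (Pi.single i 1 - Pi.single j 1 : V → ℝ) k = 0 := by
  simp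

theorem effectiveResistance_eq_energy (hG : G.graph.Connected) (i j : V) :
    let v := pinv G.laplacian *ᵥ (Pi.single i 1 - Pi.single j 1 : V → ℝ)
    G.effectiveResistance i j = v ⬝ᵥ G.laplacian *ᵥ v := by
  intro v
  rw [laplacian_mulVec_pinv_mulVec hG (sum_single_sub_single i j), dotProduct_comm]
  rfl

theorem isDistance_effectiveResistance (hG : G.graph.Connected) :
    IsDistance G.effectiveResistance where
  self i := by simp [effectiveResistance]
  symm i j := by
    simp only [effectiveResistance]
    rw [← neg_sub (Pi.single j 1 : V → ℝ), mulVec_neg, neg_dotProduct_neg]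
  pos i j hij := by
    rw [effectiveResistance_eq_energy hG]
    -- Zero energy would make the potential constant, yet its Laplacian is `1` at `i`.
    refine lt_of_le_of_ne (G.dotProduct_laplacian_mulVec_nonneg _) fun h => ?_
    have hconst := eq_of_dotProduct_laplacian_mulVec_eq_zero hG h.symm
    have hQ := congrFun (laplacian_mulVec_pinv_mulVec hG (sum_single_sub_single i j)) i
    rw [laplacian_mulVec_apply] at hQ
    simp [hconst _ i, hij] at hQ

/-- A function that is harmonic on a set of nodes whose only boundary node is `x` is constant
there, with the value at `x`. -/
theorem eq_of_harmonicOn (hG : G.graph.Connected) {C : Set V} {x : V} (hx : x ∉ C)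
    (hC : ∀ k ∈ C, ∀ l, G.graph.Adj k l → l ≠ x → l ∈ C) {v : V → ℝ}
    (hv : ∀ k ∈ C, (G.laplacian *ᵥ v) k = 0) {j : V} (hj : j ∈ C) : v j = v x := by
  classical
  -- At each node either `w` or its Laplacian vanishes, so `w` has zero energy and is constant.
  set w : V → ℝ := fun k => if k ∈ C then v k - v x else 0 with hw
  have hQ : ∀ k ∈ C, (G.laplacian *ᵥ w) k = 0 := by
    intro k hk
    rw [← hv k hk, laplacian_mulVec_apply, laplacian_mulVec_apply]
    refine Finset.sum_congr rfl fun l _ => ?_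
    by_cases hl : l ∈ C
    · simp [hw, hk, hl]
    · rcases (G.weight_nonneg k l).eq_or_lt with h0 | hpos
      · simp [← h0]
      · have : l = x := by
          by_contra hlx
          exact hl (hC k hk l hpos hlx)
        simp [hw, hk, this, hx]
  have henergy : w ⬝ᵥ G.laplacian *ᵥ w = 0 := by
    refine Finset.sum_eq_zero fun k _ => ?_
    by_cases hk : k ∈ C
    · rw [hQ k hk, mul_zero]
    · simp [hw, hk]
  have h := eq_of_dotProduct_laplacian_mulVec_eq_zero hG henergy j x
  simp only [hw, hj, hx, if_true, if_false] at h
  exact sub_eq_zero.1 h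

/-- Split the current from `i` to `j` at `x`. The potential of the first part is harmonic on the
component of `j` off `x`, hence equal at `j` and `x`, so the cross terms of the quadratic form
vanish. -/
theorem additiveAcrossCuts_effectiveResistance (hG : G.graph.Connected) :
    AdditiveAcrossCuts G.graph G.effectiveResistance := by
  rintro x i j ⟨hi, hj, hdis⟩
  set Q' := pinv G.laplacian
  set e₁ : V → ℝ := Pi.single i 1 - Pi.single x 1 with he₁
  set e₂ : V → ℝ := Pi.single x 1 - Pi.single j 1 with he₂
  set C : Set V := {k | ∃ hk : k ∈ ({x}ᶜ : Set V),
    (G.graph.induce ({x}ᶜ : Set V)).Reachable ⟨k, hk⟩ ⟨j, hj⟩} with hCdef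
  have hxC : x ∉ C := fun ⟨hk, _⟩ => hk rfl
  have hiC : i ∉ C := fun ⟨_, h⟩ => hdis h
  have hC : ∀ k ∈ C, ∀ l, G.graph.Adj k l → l ≠ x → l ∈ C := by
    rintro k ⟨hk, hr⟩ l hkl hlx
    refine ⟨hlx, SimpleGraph.Reachable.trans (SimpleGraph.Adj.reachable ?_) hr⟩
    exact hkl.symm
  have hv : ∀ k ∈ C, (G.laplacian *ᵥ (Q' *ᵥ e₁)) k = 0 := by
    intro k hk
    rw [laplacian_mulVec_pinv_mulVec hG (sum_single_sub_single i x)]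
    have h₁ : k ≠ i := fun h => hiC (h ▸ hk)
    have h₂ : k ≠ x := fun h => hxC (h ▸ hk)
    simp [h₁, h₂]
  have hjx := eq_of_harmonicOn hG hxC hC hv ⟨hj, SimpleGraph.Reachable.refl _⟩
  have h21 : e₂ ⬝ᵥ Q' *ᵥ e₁ = 0 := by
    simp only [he₂, sub_dotProduct, single_one_dotProduct, hjx, sub_self]
  have h12 : e₁ ⬝ᵥ Q' *ᵥ e₂ = 0 := by
    rw [dotProduct_mulVec, ← mulVec_transpose, pinv_laplacian_transpose, dotProduct_comm, h21]
  have hsum : (Pi.single i 1 - Pi.single j 1 : V → ℝ) = e₁ + e₂ := by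
    rw [he₁, he₂]; abel
  simp only [effectiveResistance, hsum]
  rw [mulVec_add, dotProduct_add, add_dotProduct, add_dotProduct, h12, h21]
  ring

end WeightedGraph

end GraphVariance

open GraphVariance in
theorem mainTheorem3 {V : Type*} [Fintype V] [DecidableEq V] [Nontrivial V]
    (G : WeightedGraph V) (hG : G.graph.IsTree) :
    -- variance with respect to the square root of the effective resistance
    (∀ p : V → ℝ,
      IsMaxVarianceDistribution (fun i j => √(G.effectiveResistance i j)) p →
        {i | 0 < p i} ⊆ {i | IsLeaf G.graph i}) ∧
    ∀ d : V → V → ℝ, IsDistance d → AdditiveAcrossCuts G.graph d →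
      -- `d` in place of the effective resistance
      (∀ p : V → ℝ, IsMaxVarianceDistribution (fun i j => √(d i j)) p →
        {i | 0 < p i} ⊆ {i | IsLeaf G.graph i}) ∧
      -- variance with respect to `d` itself
      (∀ p : V → ℝ, IsMaxVarianceDistribution d p →
        {i | 0 < p i} ⊆ {i | IsLeaf G.graph i}) :=
  ⟨fun _ hp => support_subset_leaves_of_sqrt hG
      (WeightedGraph.isDistance_effectiveResistance hG.connected)
      (WeightedGraph.additiveAcrossCuts_effectiveResistance hG.connected) hp,
    fun _ hd hadd => ⟨fun _ hp => support_subset_leaves_of_sqrt hG hd hadd hp,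
      fun _ hp => support_subset_leaves hG hd hadd hp⟩⟩
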